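/- **Messages.** A finite DAG consists of transactions and acks. Each *output* has a value $\ge 0$, an owner key and a unique originating transaction. A *transaction* $t$ has a set of inputs (outputs of earlier transactions, which $t$ *spends*), a set of outputs with the same total value $m_t$ as the inputs, and a validator key, to which all its outputs are delegated. The *genesis* is a transaction without inputs; each of its outputs carries a validator key, and their total value is $M$. An *ack*, issued by a validator, contains at most one reference to an earlier ack of the same validator and a set of references to transactions that it *signs*. A transaction refers to the transactions whose outputs it spends. The messages are issued one after another, each refers only to messages issued before it, and the genesis is the only message without references. For a set $A$ of acks, $\mathrm{past}(A)$ is the set of messages reachable from $A$ by following references (zero or more). **Validators.** A set of keys is controlled by the adversary; nothing is required of these, nor of the issuers of transactions. Every other validator is honest: each of its acks refers to the last ack it issued before (if any), and it never signs two different transactions that spend a common output. **Confirmation**, relative to a set $P$ of messages, is defined inductively. The genesis is confirmed in $P$ if it lies in $P$. A transaction $t$ is confirmed in $P$ if the transactions that output the inputs of $t$ are confirmed in $P$ and there is a set of acks $A_t\subseteq P$ such that (i) some distinct validators $v_1,\dots,v_k$, each signing $t$ by an ack in $\mathrm{past}(A_t)$, have delegated stakes $m_1,\dots,m_k$ in $\mathrm{past}(A_t)$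 with $\sum_i m_i>\frac23M$, and (ii) no transaction $t'\ne t$ in $\mathrm{past}(A_t)$ shares an input with $t$. The stake delegated to $v$ in $\mathrm{past}(A)$ is the total value of the outputs delegated to $v$ of transactions confirmed in $\mathrm{past}(A)$ that are not spent by any transaction (confirmed or not) in $\mathrm{past}(A)$. The theorem holds both for this convention and for the one in which, when the stake behind the acks for $t$ is computed, spending by $t$ itself is disregarded; the same convention is used throughout. **Adversary stake.** Let $m_{t,A}$ be the total value of the inputs of $t$ that are delegated to the adversary. The adversary stake at time $\tau$ is the total value of the genesis outputs delegated to the adversary, plus $m_t-m_{t,A}$ for every non-genesis transaction $t$ with an adversary validator key issued by time $\tau$, minus $m_{t,A}$ for every non-genesis transaction $t$ with an honest validator key that is confirmed in the set of messages issued by time $\tau$. **Conflicts.** Dependence is the reflexive transitive closure of "spends an output of". Two different transactions that spend a common output conflict, and if $t_1,t_2$ conflict, then every transaction that depends on $t_1$ conflicts with every transaction that depends on $t_2$. **Theorem.** If the adversary stake is less than $M/3$ at all times, then the DAG does not contain two conflicting transactions that are both confirmed (in the set of all its messages). -/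

import Mathlib

open scoped NNReal

namespace ABC

/-- A finite DAG of messages (transactions and acks), together with the order in which the messages
were issued. `Out`, `Tx` and `Ack` are the types of the outputs, transactions and acks occurring in
it, `Key` is the type of public keys. Every transaction and ack that occurs carries the required
signatures; by unforgeability the `issuer` of an ack is the validator that really issued it. -/
structure Dag (Key Out Tx Ack : Type*) [Fintype Out] [Fintype Tx] [Fintype Ack] where
  /-- the amount of money of an output -/
  value : Out → ℝ≥0
  /-- the owner key of an output -/
  owner : Out → Key
  /-- the transaction that an output belongs to -/
  origin : Out → Tx
  /-- the genesis transaction -/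
  genesis : Tx
  /-- the outputs that a transaction spends -/
  inputs : Tx → Finset Out
  /-- the validator key of a non-genesis transaction (not used for the genesis) -/
  validator : Tx → Key
  /-- the validator key attached to an output of the genesis (not used for other outputs) -/
  genesisValidator : Out → Key
  /-- the validator that issued an ack -/
  issuer : Ack → Key
  /-- the reference of an ack to a previous ack, if there is one -/
  prev : Ack → Option Ack
  /-- the transactions that an ack signs -/
  signed : Ack → Finset Tx
  /-- the moment at which a message is issued -/
  time : Tx ⊕ Ack → ℕ

namespace Dag

variable {Key Out Tx Ack : Type*} [Fintype Out] [Fintype Tx] [Fintype Ack]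

/-- `G.Ref m m'`: the message `m` contains a reference to the message `m'`. A transaction refers to
the transactions whose outputs it spends. -/
inductive Ref (G : Dag Key Out Tx Ack) : Tx ⊕ Ack → Tx ⊕ Ack → Prop
  | input {t : Tx} {o : Out} : o ∈ G.inputs t → Ref G (Sum.inl t) (Sum.inl (G.origin o))
  | prev {a b : Ack} : G.prev a = some b → Ref G (Sum.inr a) (Sum.inr b)
  | signed {a : Ack} {t : Tx} : t ∈ G.signed a → Ref G (Sum.inr a) (Sum.inl t)

/-- The messages reachable by following references (zero or more) from an ack in `A`. -/
def past (G : Dag Key Out Tx Ack) (A : Set Ack) : Set (Tx ⊕ Ack) :=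
  {m | ∃ a ∈ A, Relation.ReflTransGen G.Ref (Sum.inr a) m}

open Classical in
/-- The total money `M`: the sum of the values of the genesis outputs. -/
noncomputable def totalMoney (G : Dag Key Out Tx Ack) : ℝ :=
  ∑ o with G.origin o = G.genesis, (G.value o : ℝ)

open Classical in
/-- The value `m_t` of a transaction: the sum of the values of its outputs. -/
noncomputable def txValue (G : Dag Key Out Tx Ack) (t : Tx) : ℝ :=
  ∑ o with G.origin o = t, (G.value o : ℝ)

open Classical in
/-- The validator to whom the value of an output is delegated. -/
noncomputable def delegate (G : Dag Key Out Tx Ack) (o : Out) : Key :=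
  if G.origin o = G.genesis then G.genesisValidator o else G.validator (G.origin o)

/-- The messages are well formed and the hash references are acyclic, with the genesis as the only
root. -/
structure WellFormed (G : Dag Key Out Tx Ack) : Prop where
  /-- messages are issued one after the other -/
  time_injective : Function.Injective G.time
  /-- a message refers only to messages issued before it -/
  time_lt_of_ref : ∀ m m', G.Ref m m' → G.time m' < G.time m
  /-- the genesis has no inputs -/
  inputs_genesis : G.inputs G.genesis = ∅
  /-- every message other than the genesis contains a reference -/
  exists_ref : ∀ m, m ≠ Sum.inl G.genesis → ∃ m', G.Ref m m'
  /-- the outputs and the inputs of a transaction have the same total value -/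
  balanced : ∀ t, t ≠ G.genesis → G.txValue t = ∑ o ∈ G.inputs t, (G.value o : ℝ)
  /-- the previous ack that an ack refers to was issued by the same validator -/
  issuer_prev : ∀ a b, G.prev a = some b → G.issuer b = G.issuer a

/-- Two different transactions that spend a common output. -/
def SharesInput (G : Dag Key Out Tx Ack) (t₁ t₂ : Tx) : Prop :=
  t₁ ≠ t₂ ∧ ∃ o, o ∈ G.inputs t₁ ∧ o ∈ G.inputs t₂

/-- The behaviour of honest validators, where `Adv` is the set of keys of the adversary: an ack
refers to the last ack that the validator issued before (so there is a reference unless it is the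
first one), and a validator never signs two transactions that spend a common output. Nothing is
required of the keys in `Adv`, nor of the issuers of transactions. -/
structure HonestFollow (G : Dag Key Out Tx Ack) (Adv : Set Key) : Prop where
  chain : ∀ a b, G.issuer a ∉ Adv → G.issuer b = G.issuer a →
    G.time (Sum.inr b) < G.time (Sum.inr a) →
    ∃ c, G.prev a = some c ∧ G.time (Sum.inr b) ≤ G.time (Sum.inr c)
  no_double_sign : ∀ a b, G.issuer a ∉ Adv → G.issuer b = G.issuer a →
    ∀ t₁ ∈ G.signed a, ∀ t₂ ∈ G.signed b, ¬ G.SharesInput t₁ t₂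

/-- Whether an output that is spent by the very transaction `t` under examination counts as spent
when the stake behind the acks for `t` is computed: `all` means that it does, `others` that only
the transactions different from `t` are taken into account. -/
inductive SpendRule
  | all
  | others

/-- The spenders that are disregarded when `t` is under examination. -/
def SpendRule.ignored : SpendRule → Tx → Set Tx
  | .all, _ => ∅
  | .others, t => {t}

open Classical in
/-- The stake delegated to `v` in the set `P` of messages: the sum of the values of the outputs
delegated to `v` that belong to a transaction in `C` (the set of the transactions confirmed in `P`)
and are not spent by any transaction in `P`, confirmed or not, except possibly those in `X`. -/
noncomputable def delegatedStake (G : Dag Key Out Tx Ack) (C X : Set Tx) (P : Set (Tx ⊕ Ack))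
    (v : Key) : ℝ :=
  ∑ o with G.origin o ∈ C ∧ G.delegate o = v ∧ ∀ s, Sum.inl s ∈ P → o ∈ G.inputs s → s ∈ X,
    (G.value o : ℝ)

/-- The validator `v` signs `t` with an ack in `P`. -/
def Signs (G : Dag Key Out Tx Ack) (P : Set (Tx ⊕ Ack)) (v : Key) (t : Tx) : Prop :=
  ∃ a, Sum.inr a ∈ P ∧ G.issuer a = v ∧ t ∈ G.signed a

/-- `G.Confirmed r P t`: the transaction `t` is confirmed in the set `P` of messages. The set `C` in
the second rule is any set of transactions confirmed in `past A`; as the stake is monotone in `C`,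
it may be taken to be the set of all of them, see `confirmed_iff`. -/
inductive Confirmed (G : Dag Key Out Tx Ack) (r : SpendRule) : Set (Tx ⊕ Ack) → Tx → Prop
  | genesis (P : Set (Tx ⊕ Ack)) : Sum.inl G.genesis ∈ P → Confirmed G r P G.genesis
  | step (P : Set (Tx ⊕ Ack)) (t : Tx) (A : Set Ack) (C : Set Tx) (S : Finset Key) :
      (∀ o ∈ G.inputs t, Confirmed G r P (G.origin o)) →
      (∀ a ∈ A, Sum.inr a ∈ P) →
      (∀ s ∈ C, Confirmed G r (G.past A) s) →
      (∀ v ∈ S, G.Signs (G.past A) v t) →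
      2 / 3 * G.totalMoney < ∑ v ∈ S, G.delegatedStake C (r.ignored t) (G.past A) v →
      (∀ t', Sum.inl t' ∈ G.past A → ¬ G.SharesInput t' t) →
      Confirmed G r P t

/-- Confirmation, spelled out with the stake computed from all the confirmed transactions. -/
theorem confirmed_iff (G : Dag Key Out Tx Ack) (r : SpendRule) (P : Set (Tx ⊕ Ack)) (t : Tx) :
    G.Confirmed r P t ↔
      (t = G.genesis ∧ Sum.inl G.genesis ∈ P) ∨
      ((∀ o ∈ G.inputs t, G.Confirmed r P (G.origin o)) ∧
        ∃ A : Set Ack, (∀ a ∈ A, Sum.inr a ∈ P) ∧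
          (∃ S : Finset Key, (∀ v ∈ S, G.Signs (G.past A) v t) ∧
            2 / 3 * G.totalMoney < ∑ v ∈ S, G.delegatedStake {s | G.Confirmed r (G.past A) s}
              (r.ignored t) (G.past A) v) ∧
          ∀ t', Sum.inl t' ∈ G.past A → ¬ G.SharesInput t' t) := by
  classical
  constructor
  · intro h
    cases h with
    | genesis _ h => exact Or.inl ⟨rfl, h⟩
    | step _ _ A C S h1 h2 h3 h4 h5 h6 =>
      refine Or.inr ⟨h1, A, h2, ⟨S, h4, lt_of_lt_of_le h5 ?_⟩, h6⟩
      refine Finset.sum_le_sum fun v _ => ?_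
      refine Finset.sum_le_sum_of_subset_of_nonneg ?_ fun o _ _ => (G.value o).coe_nonneg
      intro o ho
      simp only [Finset.mem_filter] at ho ⊢
      exact ⟨ho.1, h3 _ ho.2.1, ho.2.2⟩
  · rintro (⟨rfl, h⟩ | ⟨h1, A, h2, ⟨S, h4, h5⟩, h6⟩)
    · exact Confirmed.genesis P h
    · exact Confirmed.step P t A _ S h1 h2 (fun _ hs => hs) h4 h5 h6

/-- The messages issued up to the moment `τ`. -/
def issuedBy (G : Dag Key Out Tx Ack) (τ : ℕ) : Set (Tx ⊕ Ack) :=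
  {m | G.time m ≤ τ}

open Classical in
/-- `m_{t,A}`: the total value of the inputs of `t` that are delegated to the adversary. -/
noncomputable def advInputs (G : Dag Key Out Tx Ack) (Adv : Set Key) (t : Tx) : ℝ :=
  ∑ o ∈ G.inputs t with G.delegate o ∈ Adv, (G.value o : ℝ)

open Classical in
/-- The amount counted as delegated to the adversary at the moment `τ`: start with the genesis
outputs delegated to the adversary, add `m_t - m_{t,A}` for each transaction `t` delegated to the
adversary that has been issued, and subtract `m_{t,A}` for each transaction `t` delegated to an
honest agent that has become confirmed. -/
noncomputable def adversaryStake (G : Dag Key Out Tx Ack) (r : SpendRule) (Adv : Set Key)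
    (τ : ℕ) : ℝ :=
  (∑ o with G.origin o = G.genesis ∧ G.delegate o ∈ Adv, (G.value o : ℝ))
    + (∑ t with t ≠ G.genesis ∧ G.validator t ∈ Adv ∧ Sum.inl t ∈ G.issuedBy τ,
        (G.txValue t - G.advInputs Adv t))
    - ∑ t with t ≠ G.genesis ∧ G.validator t ∉ Adv ∧ G.Confirmed r (G.issuedBy τ) t,
        G.advInputs Adv t

/-- `t'` depends on `t`: the reflexive transitive closure of spending an output. -/
def Depends (G : Dag Key Out Tx Ack) (t' t : Tx) : Prop :=
  Relation.ReflTransGen (fun u w => ∃ o ∈ G.inputs u, G.origin o = w) t' t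

/-- Transactions that spend a common output conflict, and so do any transactions that depend on the
two members of a conflicting pair. -/
inductive Conflicts (G : Dag Key Out Tx Ack) : Tx → Tx → Prop
  | spend {t₁ t₂ : Tx} : G.SharesInput t₁ t₂ → Conflicts G t₁ t₂
  | depends {s₁ s₂ t₁ t₂ : Tx} : Conflicts G s₁ s₂ → G.Depends t₁ s₁ → G.Depends t₂ s₂ →
      Conflicts G t₁ t₂

end Dag

end ABC

namespace ABC

open Relation

/-! Everything rests on `ConfirmsBy.mem_past_or_mem_past`: of two confirmations, one has the other's
transaction in its past. Since a confirming set has no rival of its transaction in its past, rivals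
cannot both be confirmed. General conflicts reduce to rivals because confirmation passes to
ancestors.

Suppose that neither past contains the other's transaction. Induction, applied to the confirmations
on which these two rely, shows that the transactions confirmed in either past are present in both
and share no inputs. They form a ledger whose unspent outputs total M, so the two stakes, each above
2M/3, overlap in more than M/3. An honest validator behind the overlap would have signed both
transactions, and its chain of acks would put one of them into the other past. So the overlap is
delegated to the adversary.

It remains to charge the overlap at a single moment: the time τ of the last transaction confirmed in
both pasts. Adding everything confirmed by τ leaves a ledger in which the overlap is still unspent,
and `IsLedger.sum_adversary_le` bounds it by the adversary stake at τ.

The induction is on unordered pairs of (time bound, nesting depth), ordered lexicographically. Time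
comes first so that confirmations by time τ, whatever their depth, are smaller. -/

/-- Induction on unordered pairs: a pair may be replaced by two elements, each smaller than one of
the members, or one of its members by a smaller one. -/
theorem pair_induction {α : Type*} [Preorder α] [WellFoundedLT α] {p : α → α → Prop}
    (h : ∀ a b, (∀ x y, (x < a ∨ x < b) → (y < a ∨ y < b) → p x y) →
      (∀ x < a, p x b) → (∀ y < b, p a y) → p a b) (a b : α) : p a b := by
  suffices H : ∀ s : Multiset α, ∀ a b, s = {a, b} → p a b from H _ a b rfl
  intro s
  induction s using (Multiset.wellFounded_isDershowitzMannaLT (α := α)).induction with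
  | _ s ih =>
    rintro a b rfl
    refine h a b (fun x y hx hy => ih {x, y} ?_ x y rfl) (fun x hx => ih {x, b} ?_ x b rfl)
      (fun y hy => ih {a, y} ?_ a y rfl)
    · refine ⟨0, {x, y}, {a, b}, by simp, by simp, by simp, ?_⟩
      intro z hz
      have hz : z = x ∨ z = y := by simpa using hz
      rcases hz with rfl | rfl
      · simpa using hx
      · simpa using hy
    · refine ⟨{b}, {x}, {a}, by simp, ?_, ?_, by simpa using hx⟩
      · rw [Multiset.pair_comm]; rfl
      · rw [Multiset.pair_comm]; rfl
    · exact ⟨{a}, {y}, {b}, by simp, rfl, rfl, by simpa using hy⟩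

namespace Dag

variable {Key Out Tx Ack : Type*} [Fintype Out] [Fintype Tx] [Fintype Ack]
  {G : Dag Key Out Tx Ack} {r : SpendRule} {Adv : Set Key}

/-! ### Pasts and the order of issue. -/

theorem mem_past_of_reach {A : Set Ack} {m m' : Tx ⊕ Ack} (hm : m ∈ G.past A)
    (h : ReflTransGen G.Ref m m') : m' ∈ G.past A :=
  let ⟨a, ha, h'⟩ := hm
  ⟨a, ha, h'.trans h⟩

theorem past_subset_past {A B : Set Ack} (h : ∀ b ∈ B, Sum.inr b ∈ G.past A) :
    G.past B ⊆ G.past A :=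
  fun _ ⟨b, hb, hr⟩ => mem_past_of_reach (h b hb) hr

theorem SharesInput.symm {t₁ t₂ : Tx} (h : G.SharesInput t₁ t₂) : G.SharesInput t₂ t₁ :=
  let ⟨hne, o, h₁, h₂⟩ := h
  ⟨hne.symm, o, h₂, h₁⟩

theorem Signs.mem {A : Set Ack} {v : Key} {t : Tx} (h : G.Signs (G.past A) v t) :
    Sum.inl t ∈ G.past A :=
  let ⟨_, ha, _, ht⟩ := h
  mem_past_of_reach ha (.single (.signed ht))

namespace WellFormed

theorem time_le_of_reach (hG : G.WellFormed) {m m' : Tx ⊕ Ack} (h : ReflTransGen G.Ref m m') :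
    G.time m' ≤ G.time m := by
  induction h with
  | refl => exact le_rfl
  | tail _ h ih => exact (hG.time_lt_of_ref _ _ h).le.trans ih

theorem reach_genesis (hG : G.WellFormed) (m : Tx ⊕ Ack) :
    ReflTransGen G.Ref m (Sum.inl G.genesis) := by
  induction hn : G.time m using Nat.strong_induction_on generalizing m with
  | _ n ih =>
    by_cases hm : m = Sum.inl G.genesis
    · rw [hm]
    · obtain ⟨m', h⟩ := hG.exists_ref m hm
      exact (ih _ (hn ▸ hG.time_lt_of_ref _ _ h) m' rfl).head h

theorem eq_genesis_of_time_le (hG : G.WellFormed) {t : Tx}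
    (h : G.time (Sum.inl t) ≤ G.time (Sum.inl G.genesis)) : t = G.genesis :=
  Sum.inl_injective <| hG.time_injective <|
    le_antisymm h (hG.time_le_of_reach (hG.reach_genesis _))

theorem genesis_mem_past (hG : G.WellFormed) {A : Set Ack} {m : Tx ⊕ Ack} (hm : m ∈ G.past A) :
    Sum.inl G.genesis ∈ G.past A :=
  mem_past_of_reach hm (hG.reach_genesis m)

/-- The inequality is strict because a transaction and an ack are different messages and times are
injective. -/
theorem exists_time_lt_of_mem_past (hG : G.WellFormed) {A : Set Ack} {t : Tx}
    (h : Sum.inl t ∈ G.past A) : ∃ a ∈ A, G.time (Sum.inl t) < G.time (Sum.inr a) := by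
  obtain ⟨a, ha, hr⟩ := h
  refine ⟨a, ha, (hG.time_le_of_reach hr).lt_of_ne fun he => ?_⟩
  cases hG.time_injective he

theorem time_le_of_mem_past (hG : G.WellFormed) {A : Set Ack} {τ : ℕ}
    (hA : ∀ a ∈ A, G.time (Sum.inr a) ≤ τ) {m : Tx ⊕ Ack} (hm : m ∈ G.past A) : G.time m ≤ τ :=
  let ⟨a, ha, hr⟩ := hm
  (hG.time_le_of_reach hr).trans (hA a ha)

/-- The acks of an honest validator form a chain. -/
theorem reach_of_honest (hG : G.WellFormed) (hH : G.HonestFollow Adv) {a b : Ack}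
    (ha : G.issuer a ∉ Adv) (hb : G.issuer b = G.issuer a)
    (hab : G.time (Sum.inr b) ≤ G.time (Sum.inr a)) :
    ReflTransGen G.Ref (Sum.inr a) (Sum.inr b) := by
  induction hn : G.time (Sum.inr a) using Nat.strong_induction_on generalizing a with
  | _ n ih =>
    rcases hab.eq_or_lt with h | h
    · rw [hG.time_injective h]
    · obtain ⟨c, hc, hbc⟩ := hH.chain a b ha hb h
      have hi := hG.issuer_prev a c hc
      exact (ih _ (hn ▸ hG.time_lt_of_ref _ _ (.prev hc)) (hi ▸ ha) (hb.trans hi.symm) hbc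
        rfl).head (.prev hc)

end WellFormed

/-! ### Stages of confirmation -/

/-- The set `A` of acks confirms `t`, provided that the inputs of `t` are confirmed, where `conf P`
is the set of the transactions taken to be confirmed in `P`. -/
def ConfirmsWith (G : Dag Key Out Tx Ack) (r : SpendRule) (conf : Set (Tx ⊕ Ack) → Set Tx)
    (A : Set Ack) (t : Tx) : Prop :=
  ∃ S : Finset Key, (∀ v ∈ S, G.Signs (G.past A) v t) ∧
    2 / 3 * G.totalMoney <
      ∑ v ∈ S, G.delegatedStake (conf (G.past A)) (r.ignored t) (G.past A) v ∧
    ∀ t', Sum.inl t' ∈ G.past A → ¬ G.SharesInput t' t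

/-- The transactions confirmed in `P` by at most `n` nested applications of the confirmation
rule. -/
def stage (G : Dag Key Out Tx Ack) (r : SpendRule) : ℕ → Set (Tx ⊕ Ack) → Set Tx
  | 0, P => {t | t = G.genesis ∧ Sum.inl G.genesis ∈ P}
  | n + 1, P => {t | (t = G.genesis ∧ Sum.inl G.genesis ∈ P) ∨
      ((∀ o ∈ G.inputs t, G.origin o ∈ stage G r n P) ∧
        ∃ A : Set Ack, (∀ a ∈ A, Sum.inr a ∈ P) ∧ G.ConfirmsWith r (stage G r n) A t)}

theorem delegatedStake_mono {C C' : Set Tx} (h : C ⊆ C') (X : Set Tx) (P : Set (Tx ⊕ Ack))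
    (v : Key) : G.delegatedStake C X P v ≤ G.delegatedStake C' X P v := by
  classical
  refine Finset.sum_le_sum_of_subset_of_nonneg ?_ fun o _ _ => (G.value o).coe_nonneg
  intro o ho
  simp only [Finset.mem_filter] at ho ⊢
  exact ⟨ho.1, h ho.2.1, ho.2.2⟩

theorem ConfirmsWith.mono {c c' : Set (Tx ⊕ Ack) → Set Tx} (h : ∀ P, c P ⊆ c' P) {A : Set Ack}
    {t : Tx} : G.ConfirmsWith r c A t → G.ConfirmsWith r c' A t :=
  fun ⟨S, h₁, h₂, h₃⟩ =>
    ⟨S, h₁, h₂.trans_le (Finset.sum_le_sum fun v _ => delegatedStake_mono (h _) _ _ v), h₃⟩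

theorem stage_subset_succ (n : ℕ) (P : Set (Tx ⊕ Ack)) : G.stage r n P ⊆ G.stage r (n + 1) P := by
  induction n generalizing P with
  | zero => exact fun t h => Or.inl h
  | succ n ih =>
    rintro t (h | ⟨h₁, A, hA, h₂⟩)
    · exact Or.inl h
    · exact Or.inr ⟨fun o ho => ih P (h₁ o ho), A, hA, h₂.mono ih⟩

theorem stage_mono {k n : ℕ} (h : k ≤ n) (P : Set (Tx ⊕ Ack)) : G.stage r k P ⊆ G.stage r n P :=
  monotone_nat_of_le_succ (f := fun n => G.stage r n P) (fun n => stage_subset_succ n P) h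

theorem origin_mem_stage (hG : G.WellFormed) {n : ℕ} {P : Set (Tx ⊕ Ack)} {t : Tx}
    (ht : t ∈ G.stage r n P) {o : Out} (ho : o ∈ G.inputs t) : G.origin o ∈ G.stage r n P := by
  by_cases hg : t = G.genesis
  · rw [hg, hG.inputs_genesis] at ho
    simp at ho
  cases n with
  | zero => exact absurd ht.1 hg
  | succ n =>
    rcases ht with h | ⟨h, -⟩
    · exact absurd h.1 hg
    · exact stage_subset_succ n P (h o ho)

/-- The strict drop in depth feeds the induction on pairs. -/
theorem exists_confirmsWith {n : ℕ} {P : Set (Tx ⊕ Ack)} {t : Tx} (ht : t ∈ G.stage r n P)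
    (hg : t ≠ G.genesis) : ∃ k < n, ∃ A : Set Ack, (∀ a ∈ A, Sum.inr a ∈ P) ∧
      G.ConfirmsWith r (G.stage r k) A t := by
  cases n with
  | zero => exact absurd ht.1 hg
  | succ n =>
    rcases ht with h | ⟨-, A, hA, h⟩
    · exact absurd h.1 hg
    · exact ⟨n, n.lt_succ_self, A, hA, h⟩

/-- Finiteness of `Tx` lets one depth serve all members. -/
theorem exists_stage_of_forall {c : Set Tx} {P : Set (Tx ⊕ Ack)}
    (h : ∀ s ∈ c, ∃ n, s ∈ G.stage r n P) : ∃ n, c ⊆ G.stage r n P := by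
  classical
  choose! f hf using h
  exact ⟨Finset.univ.sup f, fun s hs => stage_mono (Finset.le_sup (Finset.mem_univ s)) P (hf s hs)⟩

theorem Confirmed.exists_stage {P : Set (Tx ⊕ Ack)} {t : Tx} (h : G.Confirmed r P t) :
    ∃ n, t ∈ G.stage r n P := by
  induction h with
  | genesis P h => exact ⟨0, rfl, h⟩
  | step P t A C S _ hA _ hS hM hX ih₁ ih₂ =>
    obtain ⟨n, hn⟩ := exists_stage_of_forall (c := {s | ∃ o ∈ G.inputs t, G.origin o = s})
      (fun s ⟨o, ho, e⟩ => e ▸ ih₁ o ho)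
    obtain ⟨k, hk⟩ := exists_stage_of_forall ih₂
    refine ⟨max n k + 1, Or.inr ⟨fun o ho => ?_, A, hA, S, hS, ?_, hX⟩⟩
    · exact stage_mono (le_max_left n k) P (hn ⟨o, ho, rfl⟩)
    · refine hM.trans_le (Finset.sum_le_sum fun v _ => delegatedStake_mono ?_ _ _ v)
      exact hk.trans (stage_mono (le_max_right n k) _)

theorem Confirmed.origin (hG : G.WellFormed) {P : Set (Tx ⊕ Ack)} {t : Tx}
    (h : G.Confirmed r P t) {o : Out} (ho : o ∈ G.inputs t) : G.Confirmed r P (G.origin o) := by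
  cases h with
  | genesis => simp [hG.inputs_genesis] at ho
  | step _ _ A C S h => exact h o ho

/-- The set `A` confirms `t` in the sense of the stage `x.2`, and was issued by the time `x.1`. -/
def ConfirmsBy (G : Dag Key Out Tx Ack) (r : SpendRule) (x : ℕ ×ₗ ℕ) (A : Set Ack) (t : Tx) :
    Prop :=
  (∀ a ∈ A, G.time (Sum.inr a) ≤ (ofLex x).1) ∧ G.ConfirmsWith r (G.stage r (ofLex x).2) A t

/-! ### Conservation of money -/

theorem totalMoney_nonneg : 0 ≤ G.totalMoney :=
  Finset.sum_nonneg fun o _ => (G.value o).coe_nonneg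

/-- The stake threshold is nonnegative and exceeded, so somebody signs. -/
theorem ConfirmsWith.mem {c : Set (Tx ⊕ Ack) → Set Tx} {A : Set Ack} {t : Tx}
    (h : G.ConfirmsWith r c A t) : Sum.inl t ∈ G.past A := by
  obtain ⟨S, hS, hM, -⟩ := h
  obtain ⟨v, hv⟩ : S.Nonempty := by
    by_contra hne
    rw [Finset.not_nonempty_iff_eq_empty.1 hne, Finset.sum_empty] at hM
    linarith [totalMoney_nonneg (G := G)]
  exact (hS v hv).mem

theorem mem_of_mem_stage_past {n : ℕ} {A : Set Ack} {t : Tx} (h : t ∈ G.stage r n (G.past A)) :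
    Sum.inl t ∈ G.past A := by
  by_cases hg : t = G.genesis
  · cases n with
    | zero => exact hg ▸ h.2
    | succ n =>
      rcases h with h | ⟨-, B, hB, h⟩
      · exact hg ▸ h.2
      · exact past_subset_past hB h.mem
  · obtain ⟨k, -, B, hB, h⟩ := exists_confirmsWith h hg
    exact past_subset_past hB h.mem

theorem genesis_mem_stage {n : ℕ} {P : Set (Tx ⊕ Ack)} (h : Sum.inl G.genesis ∈ P) :
    G.genesis ∈ G.stage r n P :=
  stage_mono (Nat.zero_le n) P ⟨rfl, h⟩

/-- A set of transactions that contains the genesis and the origins of the inputs of its members,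
and in which no output is spent twice. -/
structure IsLedger (G : Dag Key Out Tx Ack) (D : Set Tx) : Prop where
  genesis_mem : G.genesis ∈ D
  origin_mem : ∀ t ∈ D, ∀ o ∈ G.inputs t, G.origin o ∈ D
  not_sharesInput : ∀ s ∈ D, ∀ t ∈ D, ¬ G.SharesInput s t

/-- The outputs of the members of `D` that no member of `D` spends. -/
def unspent (G : Dag Key Out Tx Ack) (D : Set Tx) : Set Out :=
  {o | G.origin o ∈ D ∧ ∀ s ∈ D, o ∉ G.inputs s}

theorem mem_unspent {D : Set Tx} {o : Out} :
    o ∈ G.unspent D ↔ G.origin o ∈ D ∧ ∀ s ∈ D, o ∉ G.inputs s :=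
  Iff.rfl

namespace IsLedger

-- Closure under origins makes every output spent in `D` an output of `D`, and the absence of shared
-- inputs means that it is counted only once.
open Classical in
theorem sum_unspent {D : Set Tx} (hD : G.IsLedger D) (f : Out → ℝ) :
    ∑ o with o ∈ G.unspent D, f o =
      ∑ t with t ∈ D, (∑ o with G.origin o = t, f o - ∑ o ∈ G.inputs t, f o) := by
  have h₁ : ∑ t with t ∈ D, ∑ o with G.origin o = t, f o = ∑ o with G.origin o ∈ D, f o := by
    rw [← Finset.sum_biUnion]
    · congr 1
      ext o
      simp
    · intro s _ t _ hst
      refine Finset.disjoint_left.2 fun o hs ht => hst ?_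
      simp only [Finset.mem_filter] at hs ht
      exact hs.2.symm.trans ht.2
  have h₂ : ∑ t with t ∈ D, ∑ o ∈ G.inputs t, f o =
      ∑ o with G.origin o ∈ D ∧ ∃ s ∈ D, o ∈ G.inputs s, f o := by
    rw [← Finset.sum_biUnion]
    · congr 1
      ext o
      simp only [Finset.mem_biUnion, Finset.mem_filter, Finset.mem_univ, true_and]
      exact ⟨fun ⟨s, hs, ho⟩ => ⟨hD.origin_mem s hs o ho, s, hs, ho⟩, fun ⟨_, h⟩ => h⟩
    · intro s hs t ht hst
      simp only [Finset.coe_filter, Finset.mem_univ, true_and, Set.mem_ofPred_eq] at hs ht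
      exact Finset.disjoint_left.2 fun o hos hot => hD.not_sharesInput s hs t ht ⟨hst, o, hos, hot⟩
  rw [Finset.sum_sub_distrib, h₁, h₂, eq_sub_iff_add_eq, ← Finset.sum_union]
  · congr 1
    ext o
    simp only [mem_unspent, Finset.mem_union, Finset.mem_filter, Finset.mem_univ, true_and]
    by_cases h : ∃ s ∈ D, o ∈ G.inputs s
    · simp [h]
    · push Not at h
      exact ⟨fun h' => h'.elim And.left And.left, fun h' => Or.inl ⟨h', h⟩⟩
  · refine Finset.disjoint_left.2 fun o h h' => ?_
    simp only [mem_unspent, Finset.mem_filter, Finset.mem_univ, true_and] at h h'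
    obtain ⟨-, s, hs, ho⟩ := h'
    exact h.2 s hs ho

-- By balance, only the genesis term survives.
open Classical in
theorem sum_value_unspent (hG : G.WellFormed) {D : Set Tx} (hD : G.IsLedger D) :
    ∑ o with o ∈ G.unspent D, (G.value o : ℝ) = G.totalMoney := by
  rw [hD.sum_unspent, Finset.sum_eq_single_of_mem G.genesis (by simpa using hD.genesis_mem)]
  · simp [hG.inputs_genesis, totalMoney]
  · intro t _ ht
    rw [← hG.balanced t ht]
    exact sub_self _

-- Adversary transactions contribute `m_t - m_{t,A} ≥ 0`, so passing to all issued ones can only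
-- increase the sum; honest ones contribute `-m_{t,A} ≤ 0`, so keeping only the confirmed ones
-- increases it too.
open Classical in
theorem sum_adversary_le (hG : G.WellFormed) {D : Set Tx} (hD : G.IsLedger D) {τ : ℕ}
    (hτ : ∀ t ∈ D, G.time (Sum.inl t) ≤ τ)
    (hc : ∀ t, G.Confirmed r (G.issuedBy τ) t → t ∈ D) :
    ∑ o with o ∈ G.unspent D ∧ G.delegate o ∈ Adv, (G.value o : ℝ) ≤ G.adversaryStake r Adv τ := by
  have hdel : ∀ t ≠ G.genesis, ∀ o, G.origin o = t → G.delegate o = G.validator t := by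
    rintro t ht o rfl
    simp [delegate, ht]
  have h := hD.sum_unspent fun o => if G.delegate o ∈ Adv then (G.value o : ℝ) else 0
  simp only [← Finset.sum_filter, Finset.filter_filter] at h
  rw [h, ← Finset.add_sum_erase _ _ (a := G.genesis) (by simpa using hD.genesis_mem)]
  simp only [hG.inputs_genesis, Finset.filter_empty, Finset.sum_empty, sub_zero]
  rw [adversaryStake, add_sub_assoc]
  gcongr
  rw [← Finset.sum_filter_add_sum_filter_not _ (fun t => G.validator t ∈ Adv), sub_eq_add_neg,
    ← Finset.sum_neg_distrib]
  refine add_le_add ?_ ?_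
  · calc
      _ = ∑ t ∈ (({t | t ∈ D} : Finset Tx).erase G.genesis) with G.validator t ∈ Adv,
          (G.txValue t - G.advInputs Adv t) := by
        refine Finset.sum_congr rfl fun t ht => ?_
        simp only [Finset.mem_filter, Finset.mem_erase] at ht
        rw [advInputs, txValue]
        congr 2
        ext o
        simp only [Finset.mem_filter, Finset.mem_univ, true_and, and_iff_left_iff_imp]
        intro ho
        rw [hdel t ht.1.1 o ho]
        exact ht.2
      _ ≤ _ := by
        refine Finset.sum_le_sum_of_subset_of_nonneg ?_ ?_
        · intro t ht
          simp only [Finset.mem_filter, Finset.mem_erase, Finset.mem_univ, true_and] at ht ⊢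
          exact ⟨ht.1.1, ht.2, hτ t ht.1.2⟩
        · intro t ht _
          simp only [Finset.mem_filter] at ht
          rw [hG.balanced t ht.2.1, sub_nonneg]
          exact Finset.sum_le_sum_of_subset_of_nonneg (Finset.filter_subset _ _)
            fun o _ _ => (G.value o).coe_nonneg
  · calc
      _ = ∑ t ∈ (({t | t ∈ D} : Finset Tx).erase G.genesis) with G.validator t ∉ Adv,
          -G.advInputs Adv t := by
        refine Finset.sum_congr rfl fun t ht => ?_
        simp only [Finset.mem_filter, Finset.mem_erase] at ht
        rw [advInputs, Finset.sum_eq_zero, zero_sub]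
        intro o ho
        simp only [Finset.mem_filter, Finset.mem_univ, true_and] at ho
        exact absurd (hdel t ht.1.1 o ho.1 ▸ ho.2) ht.2
      _ ≤ _ := by
        rw [Finset.sum_neg_distrib, Finset.sum_neg_distrib, neg_le_neg_iff]
        refine Finset.sum_le_sum_of_subset_of_nonneg ?_ ?_
        · intro t ht
          simp only [Finset.mem_filter, Finset.mem_erase, Finset.mem_univ, true_and] at ht ⊢
          exact ⟨⟨ht.1, hc t ht.2.2⟩, ht.2.1⟩
        · exact fun t _ _ => Finset.sum_nonneg fun o _ => (G.value o).coe_nonneg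

end IsLedger

open Classical in
theorem sum_delegatedStake (C X : Set Tx) (P : Set (Tx ⊕ Ack)) (S : Finset Key) :
    ∑ v ∈ S, G.delegatedStake C X P v = ∑ o with G.origin o ∈ C ∧ G.delegate o ∈ S ∧
      ∀ s, Sum.inl s ∈ P → o ∈ G.inputs s → s ∈ X, (G.value o : ℝ) := by
  simp only [delegatedStake]
  rw [← Finset.sum_biUnion]
  · congr 1
    ext o
    simp only [Finset.mem_biUnion, Finset.mem_filter, Finset.mem_univ, true_and]
    exact ⟨fun ⟨v, hv, h₁, h₂, h₃⟩ => ⟨h₁, h₂ ▸ hv, h₃⟩, fun ⟨h₁, h₂, h₃⟩ => ⟨_, h₂, h₁, rfl, h₃⟩⟩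
  · intro v _ w _ hvw
    refine Finset.disjoint_left.2 fun o hv hw => hvw ?_
    simp only [Finset.mem_filter] at hv hw
    exact hv.2.2.1.symm.trans hw.2.2.1

theorem SpendRule.eq_of_mem_ignored {Tx : Type*} {r : SpendRule} {s t : Tx} (h : s ∈ r.ignored t) : s = t := by
  cases r with
  | all => exact h.elim
  | others => exact h

/-! ### Two confirmed transactions -/

/-- An honest validator that signs two transactions knows one of them when it signs the other. -/
theorem mem_past_or_mem_past_of_signs (hG : G.WellFormed) (hH : G.HonestFollow Adv)
    {A₁ A₂ : Set Ack} {t₁ t₂ : Tx} {v : Key} (hv : v ∉ Adv) (h₁ : G.Signs (G.past A₁) v t₁)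
    (h₂ : G.Signs (G.past A₂) v t₂) : Sum.inl t₁ ∈ G.past A₂ ∨ Sum.inl t₂ ∈ G.past A₁ := by
  obtain ⟨a, ha, rfl, hat⟩ := h₁
  obtain ⟨b, hb, hba, hbt⟩ := h₂
  rcases le_total (G.time (Sum.inr a)) (G.time (Sum.inr b)) with h | h
  · exact Or.inl (mem_past_of_reach hb
      ((hG.reach_of_honest hH (hba ▸ hv) hba.symm h).tail (.signed hat)))
  · exact Or.inr (mem_past_of_reach ha ((hG.reach_of_honest hH hv hba h).tail (.signed hbt)))

/-- If `t₁` and `t₂` are confirmed by `A₁` and `A₂`, then one of the two transactions was known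
when the other one was confirmed. -/
theorem ConfirmsBy.mem_past_or_mem_past (hG : G.WellFormed) (hH : G.HonestFollow Adv)
    (hStake : ∀ τ : ℕ, G.adversaryStake r Adv τ < G.totalMoney / 3) {x y : ℕ ×ₗ ℕ}
    {A₁ A₂ : Set Ack} {t₁ t₂ : Tx} (h₁ : G.ConfirmsBy r x A₁ t₁) (h₂ : G.ConfirmsBy r y A₂ t₂) :
    Sum.inl t₁ ∈ G.past A₂ ∨ Sum.inl t₂ ∈ G.past A₁ := by
  classical
  revert A₁ A₂ t₁ t₂
  refine pair_induction (p := fun x y => ∀ {A₁ A₂ : Set Ack} {t₁ t₂ : Tx},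
    G.ConfirmsBy r x A₁ t₁ → G.ConfirmsBy r y A₂ t₂ →
      Sum.inl t₁ ∈ G.past A₂ ∨ Sum.inl t₂ ∈ G.past A₁) ?_ x y
  clear x y
  intro x y ih ihx ihy A₁ A₂ t₁ t₂ h₁ h₂
  by_contra hcon
  push Not at hcon
  obtain ⟨hn₁, hn₂⟩ := hcon
  have hm₁ := h₁.2.mem
  have hm₂ := h₂.2.mem
  have hg₁ := hG.genesis_mem_past hm₁
  have hg₂ := hG.genesis_mem_past hm₂
  obtain ⟨hA₁, S₁, hS₁, hM₁, -⟩ := id h₁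
  obtain ⟨hA₂, S₂, hS₂, hM₂, -⟩ := id h₂
  have hx : toLex ((ofLex x).1, (ofLex x).2) = x := rfl
  have hy : toLex ((ofLex y).1, (ofLex y).2) = y := rfl
  set τ₁ := (ofLex x).1
  set n₁ := (ofLex x).2
  set τ₂ := (ofLex y).1
  set n₂ := (ofLex y).2
  set C₁ := G.stage r n₁ (G.past A₁) with hC₁
  set C₂ := G.stage r n₂ (G.past A₂) with hC₂
  have conf₁ : ∀ s ∈ C₁, s ≠ G.genesis → ∃ z < x, ∃ B : Set Ack, G.past B ⊆ G.past A₁ ∧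
      G.ConfirmsBy r z B s := by
    intro s hs hsg
    obtain ⟨k, hk, B, hB, h⟩ := exists_confirmsWith hs hsg
    -- Same time bound, smaller depth.
    refine ⟨toLex (τ₁, k), ?_, B, past_subset_past hB, fun b hb => ?_, h⟩
    · rw [← hx]
      exact Prod.Lex.right _ hk
    · exact hG.time_le_of_mem_past hA₁ (hB b hb)
  have conf₂ : ∀ s ∈ C₂, s ≠ G.genesis → ∃ z < y, ∃ B : Set Ack, G.past B ⊆ G.past A₂ ∧
      G.ConfirmsBy r z B s := by
    intro s hs hsg
    obtain ⟨k, hk, B, hB, h⟩ := exists_confirmsWith hs hsg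
    refine ⟨toLex (τ₂, k), ?_, B, past_subset_past hB, fun b hb => ?_, h⟩
    · rw [← hy]
      exact Prod.Lex.right _ hk
    · exact hG.time_le_of_mem_past hA₂ (hB b hb)
  have hC₁m : ∀ s ∈ C₁, Sum.inl s ∈ G.past A₁ := fun s hs => mem_of_mem_stage_past hs
  have hC₂m : ∀ s ∈ C₂, Sum.inl s ∈ G.past A₂ := fun s hs => mem_of_mem_stage_past hs
  have hC₁m' : ∀ s ∈ C₁, Sum.inl s ∈ G.past A₂ := by
    intro s hs
    by_cases hsg : s = G.genesis
    · exact hsg ▸ hg₂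
    · obtain ⟨z, hz, B, hB, h⟩ := conf₁ s hs hsg
      -- The other alternative would put `t₂` into the past of `B`, hence of `A₁`.
      exact (ihx z hz h h₂).resolve_right fun h => hn₂ (hB h)
  have hC₂m' : ∀ s ∈ C₂, Sum.inl s ∈ G.past A₁ := by
    intro s hs
    by_cases hsg : s = G.genesis
    · exact hsg ▸ hg₁
    · obtain ⟨z, hz, B, hB, h⟩ := conf₂ s hs hsg
      exact (ihy z hz h₁ h).resolve_left fun h => hn₁ (hB h)
  have noconf : ∀ D : Set Tx, (∀ s ∈ D, s ≠ G.genesis → ∃ z, (z < x ∨ z < y) ∧ ∃ B : Set Ack,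
      G.ConfirmsBy r z B s) → ∀ s ∈ D, ∀ t ∈ D, ¬ G.SharesInput s t := by
    intro D hD s hs t ht hst
    have hne : ∀ u, (∃ o, o ∈ G.inputs u) → u ≠ G.genesis := by
      rintro _ ⟨o, ho⟩ rfl
      simp [hG.inputs_genesis] at ho
    obtain ⟨z, hz, B, hB⟩ := hD s hs (hne s (hst.2.imp fun _ h => h.1))
    obtain ⟨z', hz', B', hB'⟩ := hD t ht (hne t (hst.2.imp fun _ h => h.2))
    rcases ih z z' hz hz' hB hB' with h | h
    · obtain ⟨-, _, -, -, hX⟩ := hB'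
      exact hX s h hst
    · obtain ⟨-, _, -, -, hX⟩ := hB
      exact hX t h hst.symm
  have hL : G.IsLedger (C₁ ∪ C₂) := by
    refine ⟨Or.inl (genesis_mem_stage hg₁), ?_, noconf _ ?_⟩
    · rintro t (ht | ht) o ho
      · exact Or.inl (origin_mem_stage hG ht ho)
      · exact Or.inr (origin_mem_stage hG ht ho)
    · rintro s (hs | hs) hsg
      · obtain ⟨z, hz, B, -, h⟩ := conf₁ s hs hsg
        exact ⟨z, Or.inl hz, B, h⟩
      · obtain ⟨z, hz, B, -, h⟩ := conf₂ s hs hsg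
        exact ⟨z, Or.inr hz, B, h⟩
  rw [sum_delegatedStake] at hM₁ hM₂
  set E₁ : Finset Out := {o | G.origin o ∈ C₁ ∧ G.delegate o ∈ S₁ ∧
      ∀ s, Sum.inl s ∈ G.past A₁ → o ∈ G.inputs s → s ∈ r.ignored t₁} with hE₁
  set E₂ : Finset Out := {o | G.origin o ∈ C₂ ∧ G.delegate o ∈ S₂ ∧
      ∀ s, Sum.inl s ∈ G.past A₂ → o ∈ G.inputs s → s ∈ r.ignored t₂} with hE₂
  -- The only spender that the rule may ignore is `t₁`, which is not in the past of `A₂`; so both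
  -- conventions work.
  have sp₁ : ∀ o ∈ E₁, ∀ s, Sum.inl s ∈ G.past A₁ → Sum.inl s ∈ G.past A₂ → o ∉ G.inputs s := by
    intro o ho s hs hs' hos
    simp only [hE₁, Finset.mem_filter] at ho
    exact hn₁ (SpendRule.eq_of_mem_ignored (ho.2.2.2 s hs hos) ▸ hs')
  have sp₂ : ∀ o ∈ E₂, ∀ s, Sum.inl s ∈ G.past A₁ → Sum.inl s ∈ G.past A₂ → o ∉ G.inputs s := by
    intro o ho s hs hs' hos
    simp only [hE₂, Finset.mem_filter] at ho
    exact hn₂ (SpendRule.eq_of_mem_ignored (ho.2.2.2 s hs' hos) ▸ hs)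
  have hunion : ∑ o ∈ E₁ ∪ E₂, (G.value o : ℝ) ≤ G.totalMoney := by
    rw [← hL.sum_value_unspent hG]
    refine Finset.sum_le_sum_of_subset_of_nonneg ?_ fun o _ _ => (G.value o).coe_nonneg
    intro o ho
    simp only [mem_unspent, Finset.mem_filter, Finset.mem_univ, true_and]
    have hb : ∀ s ∈ C₁ ∪ C₂, Sum.inl s ∈ G.past A₁ ∧ Sum.inl s ∈ G.past A₂ := by
      rintro s (hs | hs)
      · exact ⟨hC₁m s hs, hC₁m' s hs⟩
      · exact ⟨hC₂m' s hs, hC₂m s hs⟩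
    rcases Finset.mem_union.1 ho with ho | ho
    · exact ⟨Or.inl (Finset.mem_filter.1 ho).2.1,
        fun s hs => sp₁ o ho s (hb s hs).1 (hb s hs).2⟩
    · exact ⟨Or.inr (Finset.mem_filter.1 ho).2.1,
        fun s hs => sp₂ o ho s (hb s hs).1 (hb s hs).2⟩
  have hinter : G.totalMoney / 3 < ∑ o ∈ E₁ ∩ E₂, (G.value o : ℝ) := by
    have := Finset.sum_union_inter (s₁ := E₁) (s₂ := E₂) (f := fun o => (G.value o : ℝ))
    linarith
  obtain ⟨d, hd, hmax⟩ := Finset.exists_max_image ({t | t ∈ C₁ ∩ C₂} : Finset Tx)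
    (fun t => G.time (Sum.inl t))
    ⟨G.genesis, by simpa using ⟨genesis_mem_stage hg₁, genesis_mem_stage hg₂⟩⟩
  simp only [Finset.mem_filter, Finset.mem_univ, true_and] at hd hmax
  set τ := G.time (Sum.inl d) with hτ
  have hτ₁ : τ < τ₁ := by
    obtain ⟨a, ha, h⟩ := hG.exists_time_lt_of_mem_past (hC₁m d hd.1)
    exact h.trans_le (hA₁ a ha)
  have hconf : ∀ s, G.Confirmed r (G.issuedBy τ) s → s ≠ G.genesis → ∃ z < x, ∃ B : Set Ack,
      (∀ b ∈ B, G.time (Sum.inr b) ≤ τ) ∧ G.ConfirmsBy r z B s := by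
    intro s hs hsg
    obtain ⟨n, hn⟩ := hs.exists_stage
    obtain ⟨k, -, B, hB, h⟩ := exists_confirmsWith hn hsg
    -- Here `k` is arbitrary; the strict drop from `τ₁` to `τ` compensates.
    refine ⟨toLex (τ, k), ?_, B, hB, hB, h⟩
    rw [← hx]
    exact Prod.Lex.left _ _ hτ₁
  have htime : ∀ s, G.Confirmed r (G.issuedBy τ) s → G.time (Sum.inl s) ≤ τ := by
    intro s hs
    by_cases hsg : s = G.genesis
    · rw [hsg]
      exact hG.time_le_of_reach (hG.reach_genesis _)
    · obtain ⟨z, -, B, hB, h⟩ := hconf s hs hsg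
      exact hG.time_le_of_mem_past hB h.2.mem
  have hL' : G.IsLedger (C₁ ∩ C₂ ∪ {s | G.Confirmed r (G.issuedBy τ) s}) := by
    refine ⟨Or.inl ⟨genesis_mem_stage hg₁, genesis_mem_stage hg₂⟩, ?_, noconf _ ?_⟩
    · rintro t (ht | ht) o ho
      · exact Or.inl ⟨origin_mem_stage hG ht.1 ho, origin_mem_stage hG ht.2 ho⟩
      · exact Or.inr (Confirmed.origin hG ht ho)
    · rintro s (hs | hs) hsg
      · obtain ⟨z, hz, B, -, h⟩ := conf₁ s hs.1 hsg
        exact ⟨z, Or.inl hz, B, h⟩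
      · obtain ⟨z, hz, B, -, h⟩ := hconf s hs hsg
        exact ⟨z, Or.inl hz, B, h⟩
  refine lt_asymm (hStake τ) (hinter.trans_le (le_trans ?_ (hL'.sum_adversary_le hG ?_ ?_)))
  · refine Finset.sum_le_sum_of_subset_of_nonneg ?_ fun o _ _ => (G.value o).coe_nonneg
    intro o ho
    obtain ⟨ho₁, ho₂⟩ := Finset.mem_inter.1 ho
    have hm₁ := (Finset.mem_filter.1 ho₁).2
    have hm₂ := (Finset.mem_filter.1 ho₂).2
    simp only [mem_unspent, Finset.mem_filter, Finset.mem_univ, true_and]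
    refine ⟨⟨Or.inl ⟨hm₁.1, hm₂.1⟩, ?_⟩, ?_⟩
    · rintro s (hs | hs) hos
      · exact sp₁ o ho₁ s (hC₁m s hs.1) (hC₂m s hs.2) hos
      · have hsg : s ≠ G.genesis := by
          rintro rfl
          simp [hG.inputs_genesis] at hos
        have hdg : d ≠ G.genesis := by
          intro hdg
          have := htime s hs
          rw [hτ, hdg] at this
          exact hsg (hG.eq_genesis_of_time_le this)
        obtain ⟨z, hz, B, hBτ, hB⟩ := hconf s hs hsg
        -- `B` was issued by the time of `d`, so it cannot know `d`; by induction the confirmations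
        -- of `d` in both pasts know `s`, and a spender in both pasts is excluded.
        have hdB : Sum.inl d ∉ G.past B := by
          intro h
          obtain ⟨b, hb, h⟩ := hG.exists_time_lt_of_mem_past h
          exact (hBτ b hb).not_gt h
        obtain ⟨z₁, hz₁, B₁, hB₁, hc₁⟩ := conf₁ d hd.1 hdg
        obtain ⟨z₂, hz₂, B₂, hB₂, hc₂⟩ := conf₂ d hd.2 hdg
        exact sp₁ o ho₁ s
          (hB₁ ((ih z z₁ (Or.inl hz) (Or.inl hz₁) hB hc₁).resolve_right hdB))
          (hB₂ ((ih z z₂ (Or.inl hz) (Or.inr hz₂) hB hc₂).resolve_right hdB)) hos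
    · by_contra hv
      rcases mem_past_or_mem_past_of_signs hG hH hv (hS₁ _ hm₁.2.1) (hS₂ _ hm₂.2.1) with h | h
      · exact hn₁ h
      · exact hn₂ h
  · rintro t (ht | ht)
    · exact hmax t ht
    · exact htime t ht
  · exact fun t ht => Or.inr ht

/-! ### From conflicts to shared inputs. -/

theorem Confirmed.of_depends (hG : G.WellFormed) {P : Set (Tx ⊕ Ack)} {s t : Tx}
    (h : G.Depends t s) (ht : G.Confirmed r P t) : G.Confirmed r P s := by
  induction h with
  | refl => exact ht
  | tail _ h ih =>
    obtain ⟨o, ho, rfl⟩ := h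
    exact ih.origin hG ho

theorem Conflicts.exists_sharesInput (hG : G.WellFormed) {P : Set (Tx ⊕ Ack)} {t₁ t₂ : Tx}
    (h : G.Conflicts t₁ t₂) (h₁ : G.Confirmed r P t₁) (h₂ : G.Confirmed r P t₂) :
    ∃ s₁ s₂, G.Confirmed r P s₁ ∧ G.Confirmed r P s₂ ∧ G.SharesInput s₁ s₂ := by
  induction h with
  | spend h => exact ⟨_, _, h₁, h₂, h⟩
  | depends _ hd₁ hd₂ ih => exact ih (h₁.of_depends hG hd₁) (h₂.of_depends hG hd₂)

theorem Confirmed.exists_confirmsBy {P : Set (Tx ⊕ Ack)} {t : Tx} (h : G.Confirmed r P t)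
    (hg : t ≠ G.genesis) : ∃ x A, G.ConfirmsBy r x A t := by
  obtain ⟨n, hn⟩ := h.exists_stage
  obtain ⟨k, -, A, -, hA⟩ := exists_confirmsWith hn hg
  -- There are finitely many messages, so the latest time bounds every ack.
  exact ⟨toLex (Finset.univ.sup G.time, k), A, fun a _ => Finset.le_sup (Finset.mem_univ _), hA⟩

end Dag

end ABC

theorem mainTheorem1 {Key Out Tx Ack : Type*} [Fintype Out] [Fintype Tx] [Fintype Ack]
    (G : ABC.Dag Key Out Tx Ack) (Adv : Set Key) (r : ABC.Dag.SpendRule)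
    (hG : G.WellFormed) (hHonest : G.HonestFollow Adv)
    (hStake : ∀ τ : ℕ, G.adversaryStake r Adv τ < G.totalMoney / 3) :
    ¬ ∃ t₁ t₂ : Tx, G.Confirmed r Set.univ t₁ ∧ G.Confirmed r Set.univ t₂ ∧
      G.Conflicts t₁ t₂ := by
  rintro ⟨t₁, t₂, h₁, h₂, h⟩
  obtain ⟨s₁, s₂, h₁, h₂, hne, o, ho₁, ho₂⟩ := h.exists_sharesInput hG h₁ h₂
  have hg : ∀ s, o ∈ G.inputs s → s ≠ G.genesis := by
    rintro _ ho rfl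
    simp [hG.inputs_genesis] at ho
  obtain ⟨x, A, hA⟩ := h₁.exists_confirmsBy (hg _ ho₁)
  obtain ⟨y, B, hB⟩ := h₂.exists_confirmsBy (hg _ ho₂)
  rcases hA.mem_past_or_mem_past hG hHonest hStake hB with h | h
  · obtain ⟨-, _, -, -, hX⟩ := hB
    exact hX _ h ⟨hne, o, ho₁, ho₂⟩
  · obtain ⟨-, _, -, -, hX⟩ := hA
    exact hX _ h ⟨hne.symm, o, ho₂, ho₁⟩
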